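/- A sampler feeds a transmitter that always transmits the most recently sampled undelivered packet over an erasure channel; a transmission takes one slot and succeeds independently with probability $q$, where $0<q\le 1$. Consider the Markov decision process with states $(v_1,v_2)$, $1\le v_2\le v_1$ (age of the monitor and age of the packet held by the transmitter), and $(v_1,\infty)$, $v_1\ge 1$ (no packet held), with actions $a\in\{0,1\}$ ($a=1$: sample a fresh packet, which replaces any packet held), and with the following transitions. Under $a=1$ the state moves to $(1,\infty)$ with probability $q$ and to $(v_1+1,1)$ with probability $1-q$. Under $a=0$ the state $(v_1,v_2)$ with $v_2<\infty$ moves to $(v_2+1,\infty)$ with probability $q$ and to $(v_1+1,v_2+1)$ with probability $1-q$, and the state $(v_1,\infty)$ moves to $(v_1+1,\infty)$. For a multiplier $\lambda\ge 0$ the one-slot cost is $C_1(s,a;\lambda)=v_1+\lambda\mathbf 1_{a=1}$. Let $\mathcal S$ be the state space with positive integer ages and $\bar{\mathcal S}\supset\mathcal S$ the one with real ages at least $1$. For $0<\alpha<1$ and $s\in\bar{\mathcal S}$ let $$\bar V_\alpha(s,\lambda)=\inf_\pi\sum_{t=1}^\infty\alpha^{t-1}\,\mathbb E_\pi[C_1(s(t),a(t);\lambda)\mid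 s(1)=s],$$ the infimum being over all history-dependent randomized policies, and let $$\bar V_\alpha(s,\lambda;a)=C_1(s,a;\lambda)+\alpha\sum_{s'}P_a(s,s')\,\bar V_\alpha(s',\lambda).$$ Fix a real number $v\ge 1$, put $s=(v,\infty)$, and let $$\lambda_\alpha(s)=\inf\{\lambda\ge 0:\bar V_\alpha(s,\lambda;0)=\bar V_\alpha(s,\lambda;1)\}$$ (with $\inf\emptyset=\infty$). Let $\bar\pi_s$ be the stationary policy on $\mathcal S$ that samples if and only if a packet is held and its age is at least $v$, or no packet is held and the age of the monitor is at least $v$. Let $\Pi_1$ be the set of Bernoulli-modulated simple policies on $\mathcal S$: two stationary deterministic policies that differ in exactly one state are given, one of them is chosen at time $1$ with probability $p\in(0,1)$ and the other with probability $1-p$, and the chosen one is used forever. **Theorem.** The limit $\bar\lambda(s)=\lim_{\alpha\to1^-}\lambda_\alpha(s)$ exists and is finite, and $\bar\pi_s$ is optimal for $$\inf_{\pi\in\Pi_1}\lim_{T\to\infty}\frac1T\sum_{t=1}^T\mathbb E_\pi[C_1(s(t),a(t);\bar\lambda(s))\mid s(1)=(1,\infty)].$$ That is, under $\bar\pi_s$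 these averages converge to some $J$; for every $\pi\in\Pi_1$ the lower limit of the averages is at least $J$; and $J$ is the infimum of the limits of the averages over those $\pi\in\Pi_1$ for which the limit exists in $[0,\infty]$. -/

import Mathlib

open Filter Topology
open scoped NNReal ENNReal

namespace AgeSampling

noncomputable section

/-! ### Markov decision processes with finitely supported randomness and nonnegative costs -/

/-- A Markov decision process: transition law and one-stage cost. -/
structure MDP (S A : Type) where
  trans : S → A → PMF S
  cost : S → A → ℝ≥0∞

/-- Expectation of a nonnegative function under a discrete law. -/
def expect {X : Type} (μ : PMF X) (f : X → ℝ≥0∞) : ℝ≥0∞ := ∑' x, μ x * f x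

/-- A history-dependent randomized policy: from the list of past state-action pairs (most recent
first) and the current state, a law on actions. -/
abbrev Policy (S A : Type) := List (S × A) → S → PMF A

/-- The stationary (non-randomized) policy that uses the action `f s` in state `s`. -/
def stationary {S A : Type} (f : S → A) : Policy S A := fun _ s => PMF.pure (f s)

/-- Joint law of the past and of the current state after `n` transitions, started in `s`. -/
def historyLaw {S A : Type} (M : MDP S A) (π : Policy S A) (s : S) : ℕ → PMF (List (S × A) × S)
  | 0 => PMF.pure ([], s)
  | n + 1 => (historyLaw M π s n).bind fun hx =>
      (π hx.1 hx.2).bind fun a =>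
        (M.trans hx.2 a).map fun y => ((hx.2, a) :: hx.1, y)

/-- Law of the state-action pair used at epoch `n`; epoch `n` is the time slot `t = n + 1`. -/
def stageLaw {S A : Type} (M : MDP S A) (π : Policy S A) (s : S) (n : ℕ) : PMF (S × A) :=
  (historyLaw M π s n).bind fun hx => (π hx.1 hx.2).map fun a => (hx.2, a)

/-- Expected cost at epoch `n`. -/
def stageCost {S A : Type} (M : MDP S A) (π : Policy S A) (s : S) (n : ℕ) : ℝ≥0∞ :=
  expect (stageLaw M π s n) fun p => M.cost p.1 p.2

/-- The average `(1/T) ∑_{t=1}^T c_t` of the expected costs of the first `T` slots. -/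
def cesaro (c : ℕ → ℝ≥0∞) (T : ℕ) : ℝ≥0∞ := (∑ n ∈ Finset.range T, c n) / (T : ℝ≥0∞)

/-- The optimal discounted cost `V_α(s)`: infimum over all policies. -/
def discountedValue {S A : Type} (M : MDP S A) (α : ℝ≥0) (s : S) : ℝ≥0∞ :=
  ⨅ π : Policy S A, ∑' n : ℕ, (α : ℝ≥0∞) ^ n * stageCost M π s n

/-- `V_α(s; a)`: use `a` in the first slot and behave optimally afterwards. -/
def discountedActionValue {S A : Type} (M : MDP S A) (α : ℝ≥0) (s : S) (a : A) : ℝ≥0∞ :=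
  M.cost s a + (α : ℝ≥0∞) * expect (M.trans s a) (discountedValue M α)

/-- The law on `Bool` that gives `true` the probability `p`. -/
def coin (p : ℝ≥0) (hp : p ≤ 1) : PMF Bool :=
  PMF.ofFintype (fun b => if b then (p : ℝ≥0∞) else ((1 - p : ℝ≥0) : ℝ≥0∞)) (by
    rw [Fintype.sum_bool, if_pos rfl, if_neg (by decide), ← ENNReal.coe_add,
      add_tsub_cancel_of_le hp, ENNReal.coe_one])

/-- A Bernoulli-modulated simple policy: two stationary policies that differ in exactly one state;
at the start `f` is chosen with probability `p ∈ (0, 1)` and `g` with probability `1 - p`, and the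
chosen policy is used forever. -/
structure BernoulliModulated (S A : Type) where
  f : S → A
  g : S → A
  p : ℝ≥0
  p_pos : 0 < p
  p_lt_one : p < 1
  differ_once : ∃ s', f s' ≠ g s' ∧ ∀ s, s ≠ s' → f s = g s

/-- Expected cost at epoch `n` under a Bernoulli-modulated simple policy. -/
def BernoulliModulated.stageCost {S A : Type} (π : BernoulliModulated S A) (M : MDP S A) (s : S)
    (n : ℕ) : ℝ≥0∞ :=
  expect ((coin π.p π.p_lt_one.le).bind fun b =>
    stageLaw M (stationary (if b then π.f else π.g)) s n) fun x => M.cost x.1 x.2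

/-! ### The sampling problem -/

/-- States of the status update system, with ages in `R`. For `R = ℕ` this is the countable state
space, for `R = ℝ` its extension to real ages. -/
inductive AgeState (R : Type) [One R] [LE R] where
  /-- Monitor age `v₁`, no packet at the transmitter: the state `(v₁, ∞)`. -/
  | idle (v₁ : R) (h₁ : 1 ≤ v₁)
  /-- Monitor age `v₁`, packet of age `v₂` at the transmitter: the state `(v₁, v₂)`. -/
  | busy (v₁ v₂ : R) (h₂ : 1 ≤ v₂) (h₁₂ : v₂ ≤ v₁)

/-- Age of the monitor. -/
def AgeState.monitorAge {R : Type} [One R] [LE R] : AgeState R → R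
  | .idle v₁ _ => v₁
  | .busy v₁ _ _ _ => v₁

/-- The age to which a sampling rule reacts: the age of the packet held by the transmitter, or the
age of the monitor if no packet is held. -/
def AgeState.effectiveAge {R : Type} [One R] [LE R] : AgeState R → R
  | .idle v₁ _ => v₁
  | .busy _ v₂ _ _ => v₂

theorem AgeState.one_le_monitorAge {R : Type} [One R] [Preorder R] :
    ∀ s : AgeState R, 1 ≤ s.monitorAge
  | .idle _ h₁ => h₁
  | .busy _ _ h₂ h₁₂ => h₂.trans h₁₂

theorem one_le_succ {R : Type} [CommSemiring R] [PartialOrder R] [IsOrderedRing R] {v : R}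
    (h : 1 ≤ v) : 1 ≤ v + 1 :=
  le_add_of_le_of_nonneg h zero_le_one

/-- One slot of the system; the action `true` means that a fresh packet is sampled, which replaces
any packet held. A transmission succeeds with probability `q`.
* Sampling: to `(1, ∞)` on success, to `(v₁ + 1, 1)` on failure.
* No sampling with a packet of age `v₂`: to `(v₂ + 1, ∞)` on success, to `(v₁ + 1, v₂ + 1)` on
  failure.
* No sampling without a packet: to `(v₁ + 1, ∞)`. -/
def step {R : Type} [CommSemiring R] [PartialOrder R] [IsOrderedRing R] (q : ℝ≥0) (hq : q ≤ 1) :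
    AgeState R → Bool → PMF (AgeState R)
  | s, true => (coin q hq).map fun success =>
      if success then .idle 1 le_rfl
      else .busy (s.monitorAge + 1) 1 le_rfl (one_le_succ s.one_le_monitorAge)
  | .idle v₁ h₁, false => PMF.pure (.idle (v₁ + 1) (one_le_succ h₁))
  | .busy v₁ v₂ h₂ h₁₂, false => (coin q hq).map fun success =>
      if success then .idle (v₂ + 1) (one_le_succ h₂)
      else .busy (v₁ + 1) (v₂ + 1) (one_le_succ h₂) (add_le_add_left h₁₂ 1)

/-- The dual (Lagrangian) MDP with multiplier `lam`: the cost of a slot is the monitor age, plus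
`lam` if a packet is sampled. -/
def dualMDP (R : Type) [CommSemiring R] [PartialOrder R] [IsOrderedRing R] [Algebra R ℝ]
    (q : ℝ≥0) (hq : q ≤ 1) (lam : ℝ≥0) : MDP (AgeState R) Bool where
  trans := step q hq
  cost s a := ENNReal.ofReal (algebraMap R ℝ s.monitorAge) + if a then (lam : ℝ≥0∞) else 0

/-- `λ_α(v, ∞)`: the infimum of the multipliers `lam ≥ 0` for which, in the discounted dual MDP with
real ages, both actions have the same value in the state `(v, ∞)`. It is `∞` if there is none. -/
def criticalMultiplier (q : ℝ≥0) (hq : q ≤ 1) (v : ℝ) (hv : 1 ≤ v) (α : ℝ≥0) : ℝ≥0∞ :=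
  ⨅ (lam : ℝ≥0) (_ : discountedActionValue (dualMDP ℝ q hq lam) α (.idle v hv) false =
    discountedActionValue (dualMDP ℝ q hq lam) α (.idle v hv) true), (lam : ℝ≥0∞)

open Classical in
/-- The threshold rule on the integer states: sample iff the age of the packet held (or the age of
the monitor, if no packet is held) is at least `v`. -/
def thresholdRule (v : ℝ) : AgeState ℕ → Bool := fun s => decide (v ≤ (s.effectiveAge : ℝ))

/-- The initial state `(1, ∞)`. -/
def initState : AgeState ℕ := .idle 1 le_rfl

end

end AgeSampling

/-! The optimality equations have an explicit solution. Let `x` be the effective age. A state `(v₁,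
∞)` behaves like `(v₁, v₁)`, and sampling amounts to paying `λ` and then waiting with a packet of
age 0. This suggests the ansatz `A v₁ + E - D(x)` with `A = 1 / (1 - α (1 - q))`. The equation
reduces to `D(x) = max (0, c (u - x) + α D(x + 1))` with `c = α q A` and `λ = D(0)`. It is solved by
`D(x) = c ∑ αⁱ (u - x - i)⁺`, and sampling is optimal iff `x ≥ u`. `potential_add_le` and
`le_potential_add` state this for discounted and average cost at once.

Discounted case: at `(v, ∞)` with `u ≤ v`, waiting exceeds sampling by `c (v - u)`. As `D(0)`
depends continuously on `u` and vanishes at `u = 0`, every smaller multiplier comes from some `u <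
v` and is not critical. So `λ_α(s)` is `D(0)` for `u = v` (`criticalMultiplier_eq`), which is
continuous at `α = 1`.

Average case: at `α = 1` the same formula gives a relative value function and the average cost `1/q
+ v`, attained by the threshold rule. The lower bound holds for every policy
(`averageLevel_le_liminf`), although the expected age need not stay bounded: an age that is large
now has already cost quadratically much, so the boundary term is negligible (`le_liminf_cesaro`).
Mixtures inherit the bound. The infimum is attained in the class by mixing the threshold rule with
its modification at the unreachable state `(1, 1)`. -/

namespace AgeSampling

/-! ### Expectations under discrete laws -/

section Expect

variable {X Y : Type}

theorem expect_pure (x : X) (f : X → ℝ≥0∞) : expect (PMF.pure x) f = f x := by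
  unfold expect
  rw [tsum_eq_single x]
  · simp
  · intro y hy
    simp [PMF.pure_apply, hy]

theorem expect_bind (μ : PMF X) (k : X → PMF Y) (f : Y → ℝ≥0∞) :
    expect (μ.bind k) f = expect μ fun x => expect (k x) f := by
  unfold expect
  simp only [PMF.bind_apply, ← ENNReal.tsum_mul_right, ← ENNReal.tsum_mul_left]
  rw [ENNReal.tsum_comm]
  simp only [mul_assoc]

theorem expect_map (μ : PMF X) (g : X → Y) (f : Y → ℝ≥0∞) :
    expect (μ.map g) f = expect μ fun x => f (g x) := by
  rw [← PMF.bind_pure_comp, expect_bind]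
  simp [expect_pure]

theorem expect_mono (μ : PMF X) {f g : X → ℝ≥0∞} (h : ∀ x, f x ≤ g x) :
    expect μ f ≤ expect μ g :=
  ENNReal.tsum_le_tsum fun x => mul_le_mul_right (h x) _

theorem expect_add (μ : PMF X) (f g : X → ℝ≥0∞) :
    expect μ (fun x => f x + g x) = expect μ f + expect μ g := by
  simp [expect, mul_add, ENNReal.tsum_add]

theorem expect_const_mul (μ : PMF X) (b : ℝ≥0∞) (f : X → ℝ≥0∞) :
    expect μ (fun x => b * f x) = b * expect μ f := by
  simp only [expect, ← ENNReal.tsum_mul_left]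
  exact tsum_congr fun x => mul_left_comm _ _ _

theorem expect_const (μ : PMF X) (b : ℝ≥0∞) : expect μ (fun _ => b) = b := by
  simp [expect, ENNReal.tsum_mul_right, PMF.tsum_coe]

theorem expect_coin (p : ℝ≥0) (hp : p ≤ 1) (f : Bool → ℝ≥0∞) :
    expect (coin p hp) f = p * f true + ((1 - p : ℝ≥0) : ℝ≥0∞) * f false := by
  simp [expect, coin, tsum_fintype]

end Expect

/-! ### Supersolutions and subsolutions of the optimality equations -/

section Verification

variable {S A : Type} (M : MDP S A) (π : Policy S A) (s : S)

/-- Expectation of a function of the state after `n` transitions. -/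
noncomputable def stateExpect (Φ : S → ℝ≥0∞) (n : ℕ) : ℝ≥0∞ :=
  expect (historyLaw M π s n) fun hx => Φ hx.2

theorem stateExpect_zero (Φ : S → ℝ≥0∞) : stateExpect M π s Φ 0 = Φ s := by
  simp [stateExpect, historyLaw, expect_pure]

theorem stateExpect_succ (Φ : S → ℝ≥0∞) (n : ℕ) :
    stateExpect M π s Φ (n + 1) = expect (historyLaw M π s n) fun hx =>
      expect (π hx.1 hx.2) fun a => expect (M.trans hx.2 a) Φ := by
  simp only [stateExpect, historyLaw, expect_bind, expect_map]

theorem stageCost_eq (n : ℕ) :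
    stageCost M π s n = expect (historyLaw M π s n) fun hx =>
      expect (π hx.1 hx.2) fun a => M.cost hx.2 a := by
  simp only [stageCost, stageLaw, expect_bind, expect_map]

theorem stageCost_add_stateExpect_succ (β : ℝ≥0∞) (Φ : S → ℝ≥0∞) (n : ℕ) :
    stageCost M π s n + β * stateExpect M π s Φ (n + 1) =
      expect (historyLaw M π s n) fun hx => expect (π hx.1 hx.2) fun a =>
        M.cost hx.2 a + β * expect (M.trans hx.2 a) Φ := by
  simp only [stageCost_eq, stateExpect_succ, ← expect_const_mul, ← expect_add]

theorem stateExpect_add_const (Φ : S → ℝ≥0∞) (γ : ℝ≥0∞) (n : ℕ) :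
    stateExpect M π s Φ n + γ = stateExpect M π s (fun x => Φ x + γ) n := by
  simp only [stateExpect, expect_add, expect_const]

/-- Keeping both `β` and `γ` lets one step serve two problems: `γ = 0` for discounted cost, `β = 1`
for average cost. -/
theorem stateExpect_add_le {β γ : ℝ≥0∞} {Φ : S → ℝ≥0∞}
    (h : ∀ x a, Φ x + γ ≤ M.cost x a + β * expect (M.trans x a) Φ) (n : ℕ) :
    stateExpect M π s Φ n + γ ≤ stageCost M π s n + β * stateExpect M π s Φ (n + 1) := by
  rw [stageCost_add_stateExpect_succ, stateExpect_add_const]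
  refine expect_mono _ fun hx => ?_
  beta_reduce
  rw [← expect_const (π hx.1 hx.2) (Φ hx.2 + γ)]
  exact expect_mono _ fun a => h _ _

theorem le_stateExpect_add {β γ : ℝ≥0∞} {Φ : S → ℝ≥0∞} {f : S → A}
    (h : ∀ x, M.cost x (f x) + β * expect (M.trans x (f x)) Φ ≤ Φ x + γ) (n : ℕ) :
    stageCost M (stationary f) s n + β * stateExpect M (stationary f) s Φ (n + 1) ≤
      stateExpect M (stationary f) s Φ n + γ := by
  rw [stageCost_add_stateExpect_succ, stateExpect_add_const]
  refine expect_mono _ fun hx => ?_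
  simpa only [stationary, expect_pure] using h hx.2

theorem stateExpect_succ_le {b : ℝ≥0∞} {Φ : S → ℝ≥0∞}
    (h : ∀ x a, expect (M.trans x a) Φ ≤ Φ x + b) (n : ℕ) :
    stateExpect M π s Φ (n + 1) ≤ stateExpect M π s Φ n + b := by
  rw [stateExpect_succ, stateExpect_add_const]
  refine expect_mono _ fun hx => ?_
  beta_reduce
  rw [← expect_const (π hx.1 hx.2) (Φ hx.2 + b)]
  exact expect_mono _ fun a => h _ _

theorem stateExpect_le {b : ℝ≥0∞} {Φ : S → ℝ≥0∞}
    (h : ∀ x a, expect (M.trans x a) Φ ≤ Φ x + b) (n : ℕ) :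
    stateExpect M π s Φ n ≤ Φ s + n * b := by
  induction n with
  | zero => simp [stateExpect_zero]
  | succ n ih =>
    refine (stateExpect_succ_le M π s h n).trans ((add_le_add_left ih b).trans_eq ?_)
    push_cast
    ring

/-- A subsolution of the discounted optimality equation of at most linear growth lies below the
value function. -/
theorem le_discountedValue {α : ℝ≥0} (hα : α < 1) {b : ℝ≥0∞} (hb : b ≠ ∞) {Φ : S → ℝ≥0∞}
    (hs : Φ s ≠ ∞) (hgrow : ∀ x a, expect (M.trans x a) Φ ≤ Φ x + b)
    (h : ∀ x a, Φ x ≤ M.cost x a + α * expect (M.trans x a) Φ) :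
    Φ s ≤ discountedValue M α s := by
  refine le_iInf fun π => ?_
  have key : ∀ n : ℕ, Φ s ≤ ∑ k ∈ Finset.range n, (α : ℝ≥0∞) ^ k * stageCost M π s k
      + (α : ℝ≥0∞) ^ n * stateExpect M π s Φ n := by
    intro n
    induction n with
    | zero => simp [stateExpect_zero]
    | succ n ih =>
      refine ih.trans ?_
      have h1 := stateExpect_add_le M π s (β := α) (γ := 0) (by simpa using h) n
      rw [add_zero] at h1
      rw [Finset.sum_range_succ, add_assoc]
      refine add_le_add_right ?_ _
      calc _ ≤ (α : ℝ≥0∞) ^ n * (stageCost M π s n + α * stateExpect M π s Φ (n + 1)) :=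
            mul_le_mul_right h1 _
        _ = _ := by ring
  -- Linear growth of `Φ` bounds the remainder after `n` slots by `αⁿ (Φ s + n b)`, which vanishes
  -- in the limit.
  have hlim : Tendsto (fun n : ℕ =>
      ((α ^ n * (Φ s).toNNReal + n * α ^ n * b.toNNReal : ℝ≥0) : ℝ≥0∞))
      atTop (𝓝 0) := by
    rw [← ENNReal.coe_zero, ENNReal.tendsto_coe]
    have h1 : Tendsto (fun n : ℕ => α ^ n) atTop (𝓝 0) :=
      NNReal.tendsto_pow_atTop_nhds_zero_of_lt_one hα
    have h2 : Tendsto (fun n : ℕ => (n : ℝ≥0) * α ^ n) atTop (𝓝 0) := by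
      rw [← NNReal.tendsto_coe]
      push_cast
      exact tendsto_self_mul_const_pow_of_lt_one α.coe_nonneg (by exact_mod_cast hα)
    simpa using (h1.mul_const _).add (h2.mul_const _)
  have htail : Tendsto (fun n : ℕ => (∑' k, (α : ℝ≥0∞) ^ k * stageCost M π s k)
      + ((α ^ n * (Φ s).toNNReal + n * α ^ n * b.toNNReal : ℝ≥0) : ℝ≥0∞)) atTop
      (𝓝 ((∑' k, (α : ℝ≥0∞) ^ k * stageCost M π s k) + 0)) := tendsto_const_nhds.add hlim
  rw [add_zero] at htail
  refine ge_of_tendsto' htail fun n => (key n).trans ?_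
  refine add_le_add (ENNReal.sum_le_tsum _) ?_
  refine (mul_le_mul_right (stateExpect_le M π s hgrow n) _).trans_eq ?_
  push_cast
  rw [ENNReal.coe_toNNReal hs, ENNReal.coe_toNNReal hb]
  ring

/-- A supersolution of the discounted equation of a stationary policy lies above the value
function. -/
theorem discountedValue_le {α : ℝ≥0} {Φ : S → ℝ≥0∞} {f : S → A}
    (h : ∀ x, M.cost x (f x) + α * expect (M.trans x (f x)) Φ ≤ Φ x) :
    discountedValue M α s ≤ Φ s := by
  refine (iInf_le _ (stationary f)).trans ?_
  refine ENNReal.tsum_le_of_sum_range_le fun n => ?_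
  -- The induction carries the remainder along. It is nonnegative and is dropped at the end, so no
  -- growth condition is needed here.
  suffices ∑ k ∈ Finset.range n, (α : ℝ≥0∞) ^ k * stageCost M (stationary f) s k
      + (α : ℝ≥0∞) ^ n * stateExpect M (stationary f) s Φ n ≤ Φ s from le_self_add.trans this
  induction n with
  | zero => simp [stateExpect_zero]
  | succ n ih =>
    refine le_trans ?_ ih
    have h1 := le_stateExpect_add M s (β := α) (γ := 0) (by simpa using h) n
    rw [add_zero] at h1
    rw [Finset.sum_range_succ, add_assoc]
    refine add_le_add_right ?_ _
    calc _ = (α : ℝ≥0∞) ^ n * (stageCost M (stationary f) s n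
            + α * stateExpect M (stationary f) s Φ (n + 1)) := by ring
      _ ≤ _ := mul_le_mul_right h1 _

theorem mul_add_le_sum_stageCost {γ : ℝ≥0∞} {Φ : S → ℝ≥0∞}
    (h : ∀ x a, Φ x + γ ≤ M.cost x a + expect (M.trans x a) Φ) (n : ℕ) :
    n * γ + Φ s ≤ ∑ k ∈ Finset.range n, stageCost M π s k + stateExpect M π s Φ n := by
  induction n with
  | zero => simp [stateExpect_zero]
  | succ n ih =>
    have h1 := stateExpect_add_le M π s (β := 1) (by simpa using h) n
    rw [one_mul] at h1
    calc ((n + 1 : ℕ) : ℝ≥0∞) * γ + Φ s = n * γ + Φ s + γ := by push_cast; ring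
      _ ≤ _ := add_le_add_left ih γ
      _ = ∑ k ∈ Finset.range n, stageCost M π s k + (stateExpect M π s Φ n + γ) := by ring
      _ ≤ _ := add_le_add_right h1 _
      _ = _ := by rw [Finset.sum_range_succ]; ring

theorem sum_stageCost_le {γ : ℝ≥0∞} {Φ : S → ℝ≥0∞} {f : S → A}
    (h : ∀ x, M.cost x (f x) + expect (M.trans x (f x)) Φ ≤ Φ x + γ) (n : ℕ) :
    ∑ k ∈ Finset.range n, stageCost M (stationary f) s k ≤ n * γ + Φ s := by
  suffices ∑ k ∈ Finset.range n, stageCost M (stationary f) s k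
      + stateExpect M (stationary f) s Φ n ≤ n * γ + Φ s from le_self_add.trans this
  induction n with
  | zero => simp [stateExpect_zero]
  | succ n ih =>
    have h1 := le_stateExpect_add M s (β := 1) (by simpa using h) n
    rw [one_mul] at h1
    calc _ = ∑ k ∈ Finset.range n, stageCost M (stationary f) s k
          + (stageCost M (stationary f) s n + stateExpect M (stationary f) s Φ (n + 1)) := by
          rw [Finset.sum_range_succ]; ring
      _ ≤ _ := add_le_add_right h1 _
      _ = ∑ k ∈ Finset.range n, stageCost M (stationary f) s k
          + stateExpect M (stationary f) s Φ n + γ := by ring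
      _ ≤ _ := add_le_add_left ih γ
      _ = _ := by push_cast; ring

end Verification

/-! ### Long-run averages -/

/-- The square grows by at most `2 m n + 1` per slot, and `m n` is paid for by `c n`. Hence `m n` is
of the order of the square root of the total cost plus `n`. -/
theorem sq_le_of_le_add_one {c m : ℕ → ℝ≥0∞} (h0 : m 0 ≤ 1) (hstep : ∀ n, m (n + 1) ≤ m n + 1)
    (hmc : ∀ n, m n ≤ c n) (n : ℕ) :
    m n ^ 2 ≤ 2 * ∑ k ∈ Finset.range n, c k + n + 1 := by
  induction n with
  | zero => simpa using pow_le_pow_left' h0 2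
  | succ n ih =>
    calc m (n + 1) ^ 2 ≤ (m n + 1) ^ 2 := pow_le_pow_left' (hstep n) 2
      _ = m n ^ 2 + 2 * m n + 1 := by ring
      _ ≤ (2 * ∑ k ∈ Finset.range n, c k + n + 1) + 2 * c n + 1 := by
        gcongr
        exact hmc n
      _ = _ := by rw [Finset.sum_range_succ]; push_cast; ring

/-- If the total cost of `n` slots is at least `n * g` up to a multiple of a quantity `m n` that
grows at most by one in each slot and is dominated by the cost of the slot, then the long-run
average cost is at least `g`. -/
theorem le_liminf_cesaro {c m : ℕ → ℝ≥0∞} {g A C : ℝ≥0} (h0 : m 0 ≤ 1)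
    (hstep : ∀ n, m (n + 1) ≤ m n + 1) (hmc : ∀ n, m n ≤ c n)
    (h : ∀ n : ℕ, n * (g : ℝ≥0∞) ≤ ∑ k ∈ Finset.range n, c k + A * m n + C) :
    (g : ℝ≥0∞) ≤ liminf (cesaro c) atTop := by
  have hfin : ∀ n, m n ≠ ∞ := by
    intro n
    induction n with
    | zero => exact ne_top_of_le_ne_top ENNReal.one_ne_top h0
    | succ n ih =>
      exact ne_top_of_le_ne_top (ENNReal.add_ne_top.2 ⟨ih, ENNReal.one_ne_top⟩) (hstep n)
  refine le_of_forall_lt fun b' hb' => ?_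
  obtain ⟨b, hb1, hb2⟩ := ENNReal.lt_iff_exists_nnreal_btwn.1 hb'
  refine hb1.trans_le ?_
  have hbg : (b : ℝ) < g := by exact_mod_cast hb2
  -- Chosen so that, if the total cost were below `b * n`, the term `ε * m n ^ 2` would use up only
  -- half of the gap `n * (g - b)`, up to the constant `ε`.
  set ε : ℝ := (g - b) / (2 * (1 + 2 * b)) with hε
  have hb0 : (0 : ℝ) ≤ b := b.coe_nonneg
  have hε0 : 0 < ε := div_pos (sub_pos.2 hbg) (by positivity)
  have hεeq : (1 + 2 * b) * ε = (g - b) / 2 := by rw [hε]; field_simp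
  refine le_liminf_of_le (by isBoundedDefault) ?_
  obtain ⟨n₀, hn₀⟩ := exists_nat_gt ((ε + A ^ 2 / (4 * ε) + C) * 2 / (g - b : ℝ))
  filter_upwards [eventually_gt_atTop n₀, eventually_gt_atTop 0] with n hn hn0
  have hnpos : (0 : ℝ) < n := by exact_mod_cast hn0
  rw [cesaro, ENNReal.le_div_iff_mul_le (by simp [hn0.ne']) (by simp)]
  by_cases hS : ∑ k ∈ Finset.range n, c k = ∞
  · simp [hS]
  obtain ⟨S, hSe⟩ : ∃ S : ℝ≥0, (S : ℝ≥0∞) = ∑ k ∈ Finset.range n, c k :=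
    ⟨_, ENNReal.coe_toNNReal hS⟩
  obtain ⟨x, hx⟩ : ∃ x : ℝ≥0, (x : ℝ≥0∞) = m n := ⟨_, ENNReal.coe_toNNReal (hfin n)⟩
  have h1 := sq_le_of_le_add_one h0 hstep hmc n
  have h2 := h n
  rw [← hSe, ← hx] at h1 h2
  rw [← hSe]
  have h1' : (x : ℝ) ^ 2 ≤ 2 * S + n + 1 := by exact_mod_cast h1
  have h2' : (n : ℝ) * g ≤ S + A * x + C := by exact_mod_cast h2
  -- Young's inequality trades the linear boundary term for a small multiple of the square.
  have h3 : (A : ℝ) * x ≤ ε * x ^ 2 + A ^ 2 / (4 * ε) := by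
    have : ε * (x : ℝ) ^ 2 + A ^ 2 / (4 * ε) - A * x = (2 * ε * x - A) ^ 2 / (4 * ε) := by
      field_simp
      ring
    have h4 : 0 ≤ (2 * ε * (x : ℝ) - A) ^ 2 / (4 * ε) := by positivity
    linarith
  have h5 : (ε + A ^ 2 / (4 * ε) + C) * 2 < n * (g - b : ℝ) := by
    rw [← div_lt_iff₀ (sub_pos.2 hbg)]
    exact hn₀.trans (by exact_mod_cast hn)
  suffices (b : ℝ) * n ≤ S by exact_mod_cast this
  by_contra! hlt
  have h6 : ε * (x : ℝ) ^ 2 ≤ ε * (2 * (b * n) + n + 1) :=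
    mul_le_mul_of_nonneg_left (by linarith) hε0.le
  have h7 : ε * (2 * (b * n) + n + 1) = n * ((g - b) / 2) + ε := by
    rw [← hεeq]
    ring
  linarith

theorem tendsto_cesaro {c : ℕ → ℝ≥0∞} {g : ℝ≥0∞} {C : ℝ≥0} (hlow : g ≤ liminf (cesaro c) atTop)
    (h : ∀ n : ℕ, ∑ k ∈ Finset.range n, c k ≤ n * g + C) :
    Tendsto (cesaro c) atTop (𝓝 g) := by
  refine tendsto_of_le_liminf_of_limsup_le hlow ?_
  have h0 : Tendsto (fun n : ℕ => (C : ℝ≥0∞) / n) atTop (𝓝 0) := by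
    simpa using ENNReal.Tendsto.const_div (a := (C : ℝ≥0∞)) ENNReal.tendsto_nat_nhds_top
      (by simp)
  have hlim : Tendsto (fun n : ℕ => g + (C : ℝ≥0∞) / n) atTop (𝓝 (g + 0)) :=
    tendsto_const_nhds.add h0
  rw [add_zero] at hlim
  rw [← hlim.limsup_eq]
  refine limsup_le_limsup ?_
  filter_upwards [eventually_gt_atTop 0] with n hn
  rw [cesaro]
  refine (ENNReal.div_le_div_right (h n) _).trans_eq ?_
  rw [ENNReal.add_div, mul_comm, ENNReal.mul_div_cancel_right (by simp [hn.ne']) (by simp)]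

/-! ### Mixtures of two stationary policies -/

section Modulated

variable {S A : Type} (M : MDP S A) (π : BernoulliModulated S A) (s : S)

theorem BernoulliModulated.stageCost_eq (n : ℕ) :
    π.stageCost M s n = π.p * AgeSampling.stageCost M (stationary π.f) s n
      + ((1 - π.p : ℝ≥0) : ℝ≥0∞) * AgeSampling.stageCost M (stationary π.g) s n := by
  simp [BernoulliModulated.stageCost, expect_bind, expect_coin, AgeSampling.stageCost]

theorem BernoulliModulated.cesaro_eq (n : ℕ) :
    cesaro (π.stageCost M s) n = π.p * cesaro (AgeSampling.stageCost M (stationary π.f) s) n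
      + ((1 - π.p : ℝ≥0) : ℝ≥0∞) * cesaro (AgeSampling.stageCost M (stationary π.g) s) n := by
  simp only [cesaro, BernoulliModulated.stageCost_eq, Finset.sum_add_distrib, ← Finset.mul_sum,
    ENNReal.add_div, mul_div_assoc]

theorem BernoulliModulated.weights_mul (g : ℝ≥0∞) :
    π.p * g + ((1 - π.p : ℝ≥0) : ℝ≥0∞) * g = g := by
  rw [← add_mul, ← ENNReal.coe_add, add_tsub_cancel_of_le π.p_lt_one.le, ENNReal.coe_one, one_mul]

theorem BernoulliModulated.le_liminf_cesaro {g : ℝ≥0∞}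
    (h : ∀ f : S → A, g ≤ liminf (cesaro (AgeSampling.stageCost M (stationary f) s)) atTop) :
    g ≤ liminf (cesaro (π.stageCost M s)) atTop := by
  refine le_of_forall_lt fun b hb => ?_
  obtain ⟨b', hbb', hb'⟩ := exists_between hb
  refine hbb'.trans_le (le_liminf_of_le (by isBoundedDefault) ?_)
  filter_upwards [eventually_lt_of_lt_liminf (hb'.trans_le (h π.f)),
    eventually_lt_of_lt_liminf (hb'.trans_le (h π.g))] with n h1 h2
  rw [BernoulliModulated.cesaro_eq, ← π.weights_mul b']
  gcongr

theorem BernoulliModulated.tendsto_cesaro {g : ℝ≥0∞}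
    (hf : Tendsto (cesaro (AgeSampling.stageCost M (stationary π.f) s)) atTop (𝓝 g))
    (hg : Tendsto (cesaro (AgeSampling.stageCost M (stationary π.g) s)) atTop (𝓝 g)) :
    Tendsto (cesaro (π.stageCost M s)) atTop (𝓝 g) := by
  rw [← π.weights_mul g, funext (π.cesaro_eq M s)]
  exact (ENNReal.Tendsto.const_mul hf (by simp)).add (ENNReal.Tendsto.const_mul hg (by simp))

end Modulated

/-! ### Explicit solution of the optimality equations -/

/-- The discounted total `c ∑ αⁱ (u - x - i)⁺` of the first `N` terms. -/
noncomputable def excess (c α u : ℝ) (N : ℕ) (x : ℝ) : ℝ :=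
  c * ∑ i ∈ Finset.range N, α ^ i * max (u - x - i) 0

section Excess

variable {c α u : ℝ} {N : ℕ}

theorem excess_nonneg (hc : 0 ≤ c) (hα : 0 ≤ α) (x : ℝ) : 0 ≤ excess c α u N x :=
  mul_nonneg hc (Finset.sum_nonneg fun i _ => mul_nonneg (pow_nonneg hα i) (le_max_right _ _))

theorem excess_eq_zero {x : ℝ} (hx : u ≤ x) : excess c α u N x = 0 := by
  refine mul_eq_zero_of_right _ (Finset.sum_eq_zero fun i _ => ?_)
  have hi : (0 : ℝ) ≤ i := i.cast_nonneg
  rw [max_eq_right (by linarith), mul_zero]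

theorem excess_antitone (hc : 0 ≤ c) (hα : 0 ≤ α) : Antitone (excess c α u N) := by
  intro x y hxy
  unfold excess
  gcongr

/-- The term of index `N` is zero when `u - x ≤ N`, so the finite sum agrees with the infinite
series, and splitting off `i = 0` shifts `x` by one. -/
theorem excess_rec {x : ℝ} (hx : u - x ≤ N) :
    excess c α u N x = c * max (u - x) 0 + α * excess c α u N (x + 1) := by
  have h : ∑ i ∈ Finset.range N, α ^ i * max (u - x - i) 0
      = ∑ i ∈ Finset.range (N + 1), α ^ i * max (u - x - i) 0 := by
    rw [Finset.sum_range_succ, max_eq_right (by linarith : u - x - N ≤ 0), mul_zero, add_zero]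
  rw [excess, h, Finset.sum_range_succ', excess, mul_add, add_comm]
  congr 1
  · simp
  · rw [mul_left_comm]
    congr 1
    rw [Finset.mul_sum]
    refine Finset.sum_congr rfl fun i _ => ?_
    rw [pow_succ', mul_assoc]
    congr 3
    push_cast
    ring

theorem excess_zero_le (hc : 0 ≤ c) (hα : 0 ≤ α) (hα1 : α < 1) (hu : 0 ≤ u) :
    excess c α u N 0 ≤ c * u / (1 - α) := by
  have h : ∑ i ∈ Finset.range N, α ^ i * max (u - 0 - i) 0 ≤ (∑ i ∈ Finset.range N, α ^ i) * u := by
    rw [Finset.sum_mul]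
    gcongr with i
    have hi : (0 : ℝ) ≤ i := i.cast_nonneg
    exact max_le (by linarith) hu
  have h2 : ∑ i ∈ Finset.range N, α ^ i ≤ (1 - α)⁻¹ := by
    rw [← tsum_geometric_of_lt_one hα hα1]
    exact (summable_geometric_of_lt_one hα hα1).sum_le_tsum _ fun i _ => pow_nonneg hα i
  calc excess c α u N 0 ≤ c * ((∑ i ∈ Finset.range N, α ^ i) * u) :=
        mul_le_mul_of_nonneg_left h hc
    _ ≤ c * ((1 - α)⁻¹ * u) := by gcongr
    _ = _ := by rw [div_eq_mul_inv]; ring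

end Excess

theorem mix_ofReal {q : ℝ≥0} (hq : q ≤ 1) {a b : ℝ} (ha : 0 ≤ a) (hb : 0 ≤ b) :
    (q : ℝ≥0∞) * ENNReal.ofReal a + ((1 - q : ℝ≥0) : ℝ≥0∞) * ENNReal.ofReal b
      = ENNReal.ofReal (q * a + (1 - q) * b) := by
  have h1 : (0 : ℝ) ≤ 1 - q := sub_nonneg.2 (by exact_mod_cast hq)
  rw [ENNReal.ofReal_add (by positivity) (by positivity), ENNReal.ofReal_mul (by positivity),
    ENNReal.ofReal_mul h1, ENNReal.ofReal_coe_nnreal, ← ENNReal.ofReal_coe_nnreal (p := 1 - q),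
    NNReal.coe_sub hq, NNReal.coe_one]

section Ages

variable {R : Type} [One R] [LE R]

@[simp] theorem AgeState.monitorAge_idle (v₁ : R) (h₁ : 1 ≤ v₁) :
    (AgeState.idle v₁ h₁).monitorAge = v₁ := rfl

@[simp] theorem AgeState.monitorAge_busy (v₁ v₂ : R) (h₂ : 1 ≤ v₂) (h₁₂ : v₂ ≤ v₁) :
    (AgeState.busy v₁ v₂ h₂ h₁₂).monitorAge = v₁ := rfl

@[simp] theorem AgeState.effectiveAge_idle (v₁ : R) (h₁ : 1 ≤ v₁) :
    (AgeState.idle v₁ h₁).effectiveAge = v₁ := rfl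

@[simp] theorem AgeState.effectiveAge_busy (v₁ v₂ : R) (h₂ : 1 ≤ v₂) (h₁₂ : v₂ ≤ v₁) :
    (AgeState.busy v₁ v₂ h₂ h₁₂).effectiveAge = v₂ := rfl

theorem AgeState.one_le_effectiveAge :
    ∀ s : AgeState R, 1 ≤ s.effectiveAge
  | .idle _ h₁ => h₁
  | .busy _ _ h₂ _ => h₂

end Ages

theorem one_le_algebraMap {R : Type} [CommSemiring R] [PartialOrder R] [Algebra R ℝ]
    (hR : Monotone (algebraMap R ℝ)) {x : R} (hx : 1 ≤ x) : 1 ≤ algebraMap R ℝ x := by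
  simpa using hR hx

/-! ### The affine ansatz and its two action values -/

section Potential

variable {R : Type} [CommSemiring R] [PartialOrder R] [IsOrderedRing R] [Algebra R ℝ]

/-- A function of the state which is affine in the monitor age. -/
noncomputable def potential (A E : ℝ) (D : ℝ → ℝ) (s : AgeState R) : ℝ≥0∞ :=
  ENNReal.ofReal (A * algebraMap R ℝ s.monitorAge + E - D (algebraMap R ℝ s.effectiveAge))

theorem expect_step_le (q : ℝ≥0) (hq : q ≤ 1) (hR : Monotone (algebraMap R ℝ)) (s : AgeState R)
    (a : Bool) {f : AgeState R → ℝ≥0∞} {b : ℝ≥0∞}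
    (h : ∀ s' : AgeState R,
      algebraMap R ℝ s'.monitorAge ≤ algebraMap R ℝ s.monitorAge + 1 → f s' ≤ b) :
    expect (step q hq s a) f ≤ b := by
  rcases a with _ | _
  · rcases s with ⟨v₁, h₁⟩ | ⟨v₁, v₂, h₂, h₁₂⟩
    · simp only [step, expect_pure]
      exact h _ (by simp [AgeState.monitorAge_idle])
    · simp only [step, expect_map]
      rw [← expect_const (coin q hq) b]
      refine expect_mono _ fun x => h _ ?_
      have := hR h₁₂
      cases x <;> simp [AgeState.monitorAge_idle, AgeState.monitorAge_busy, this]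
  · simp only [step, expect_map]
    rw [← expect_const (coin q hq) b]
    refine expect_mono _ fun x => h _ ?_
    have := one_le_algebraMap hR s.one_le_monitorAge
    cases x
    · simp [AgeState.monitorAge_busy]
    · simp only [AgeState.monitorAge_idle, if_true, map_one]
      linarith

theorem expect_step_monitorAge_le (q : ℝ≥0) (hq : q ≤ 1) (hR : Monotone (algebraMap R ℝ))
    (s : AgeState R) (a : Bool) :
    expect (step q hq s a) (fun x => ENNReal.ofReal (algebraMap R ℝ x.monitorAge)) ≤
      ENNReal.ofReal (algebraMap R ℝ s.monitorAge) + 1 := by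
  refine expect_step_le q hq hR s a fun s' hs' => ?_
  refine (ENNReal.ofReal_le_ofReal hs').trans_eq ?_
  have := one_le_algebraMap hR s.one_le_monitorAge
  rw [ENNReal.ofReal_add (by linarith) zero_le_one, ENNReal.ofReal_one]

/-- Since `0 ≤ D ≤ E`, the potential lies between `A v₁` and `A v₁ + E`, and `v₁` rises by at most
one. -/
theorem expect_step_potential_le (q : ℝ≥0) (hq : q ≤ 1) (hR : Monotone (algebraMap R ℝ))
    {A E : ℝ} {D : ℝ → ℝ} (hA : 0 ≤ A) (hD0 : ∀ x, 0 ≤ D x) (hDE : ∀ x, 0 ≤ x → D x ≤ E)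
    (s : AgeState R) (a : Bool) :
    expect (step q hq s a) (potential A E D) ≤ potential A E D s + ENNReal.ofReal (A + E) := by
  refine expect_step_le q hq hR s a fun s' hs' => ?_
  have h1 := one_le_algebraMap hR s.one_le_monitorAge
  have h2 := one_le_algebraMap hR s.one_le_effectiveAge
  have h3 := hDE _ (zero_le_one.trans h2)
  have h4 := hD0 (algebraMap R ℝ s.effectiveAge)
  have h5 := hD0 (algebraMap R ℝ s'.effectiveAge)
  have h6 := mul_le_mul_of_nonneg_left hs' hA
  have h7 : 0 ≤ A * algebraMap R ℝ s.monitorAge := mul_nonneg hA (by linarith)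
  rw [potential, potential, ← ENNReal.ofReal_add (by linarith) (by linarith)]
  exact ENNReal.ofReal_le_ofReal (by linarith)

variable {q : ℝ≥0} (hq : q ≤ 1) {α lam : ℝ≥0} {A E c u γ : ℝ} {D : ℝ → ℝ}

/-- After sampling the effective age is 1 on success and on failure alike, so the value depends on
the monitor age only. The bound `D ≤ E` keeps `ENNReal.ofReal` from truncating. -/
theorem actionValue_sample (hR : Monotone (algebraMap R ℝ)) (hA : 0 ≤ A)
    (hAeq : A = 1 + α * (1 - q) * A) (hDE : ∀ x, 0 ≤ x → D x ≤ E)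
    (hγ : γ = α * A + c * u + α * E - E) (hlam : (lam : ℝ) = c * u + α * D 1) (s : AgeState R) :
    (dualMDP R q hq lam).cost s true
        + α * expect ((dualMDP R q hq lam).trans s true) (potential A E D)
      = ENNReal.ofReal (A * algebraMap R ℝ s.monitorAge + E + γ) := by
  have h1 := one_le_algebraMap hR s.one_le_monitorAge
  have hE := hDE 1 zero_le_one
  have hp : (0 : ℝ) ≤ 1 - q := sub_nonneg.2 (by exact_mod_cast hq)
  have hs1 : 0 ≤ A * 1 + E - D 1 := by linarith
  have hs2 : 0 ≤ A * (algebraMap R ℝ s.monitorAge + 1) + E - D 1 := by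
    have : 0 ≤ A * (algebraMap R ℝ s.monitorAge + 1) := mul_nonneg hA (by linarith)
    linarith
  simp only [dualMDP, step, expect_map, expect_coin, potential, if_true,
    AgeState.monitorAge_idle, AgeState.monitorAge_busy, AgeState.effectiveAge_idle,
    AgeState.effectiveAge_busy, map_one, map_add, Bool.false_eq_true, if_false]
  rw [mix_ofReal hq hs1 hs2, ← ENNReal.ofReal_coe_nnreal (p := lam),
    ← ENNReal.ofReal_coe_nnreal (p := α), ← ENNReal.ofReal_mul α.coe_nonneg,
    ← ENNReal.ofReal_add (by linarith) lam.coe_nonneg,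
    ← ENNReal.ofReal_add (add_nonneg (by linarith) lam.coe_nonneg) (by positivity)]
  congr 1
  rw [hγ, hlam]
  linear_combination (-algebraMap R ℝ s.monitorAge) * hAeq

/-- The effective age rises by one in every outcome. Success replaces `v₁` by the effective age,
which yields the slope `c = α q A`; without a packet the two ages agree and the formula is the same.
-/
theorem actionValue_wait (hR : Monotone (algebraMap R ℝ)) (hA : 0 ≤ A)
    (hAeq : A = 1 + α * (1 - q) * A) (hc : c = α * q * A) (hDE : ∀ x, 0 ≤ x → D x ≤ E)
    (hγ : γ = α * A + c * u + α * E - E) (s : AgeState R) :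
    (dualMDP R q hq lam).cost s false
        + α * expect ((dualMDP R q hq lam).trans s false) (potential A E D)
      = ENNReal.ofReal (A * algebraMap R ℝ s.monitorAge + E + γ
          + c * (algebraMap R ℝ s.effectiveAge - u)
          - α * D (algebraMap R ℝ s.effectiveAge + 1)) := by
  have hp : (0 : ℝ) ≤ 1 - q := sub_nonneg.2 (by exact_mod_cast hq)
  rcases s with ⟨v₁, h₁⟩ | ⟨v₁, v₂, h₂, h₁₂⟩
  · have h1 := one_le_algebraMap hR h₁
    have hE := hDE (algebraMap R ℝ v₁ + 1) (by linarith)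
    have hs1 : 0 ≤ A * (algebraMap R ℝ v₁ + 1) + E - D (algebraMap R ℝ v₁ + 1) := by
      have : 0 ≤ A * (algebraMap R ℝ v₁ + 1) := mul_nonneg hA (by linarith)
      linarith
    simp only [dualMDP, step, expect_pure, potential, AgeState.monitorAge_idle,
      AgeState.effectiveAge_idle, map_one, map_add, Bool.false_eq_true, if_false, add_zero]
    rw [← ENNReal.ofReal_coe_nnreal (p := α), ← ENNReal.ofReal_mul α.coe_nonneg,
      ← ENNReal.ofReal_add (by linarith) (by positivity)]
    congr 1
    rw [hγ, hc]
    linear_combination (-algebraMap R ℝ v₁) * hAeq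
  · have h2 := one_le_algebraMap hR h₂
    have h1 := one_le_algebraMap hR (h₂.trans h₁₂)
    have hE := hDE (algebraMap R ℝ v₂ + 1) (by linarith)
    have hs1 : 0 ≤ A * (algebraMap R ℝ v₂ + 1) + E - D (algebraMap R ℝ v₂ + 1) := by
      have : 0 ≤ A * (algebraMap R ℝ v₂ + 1) := mul_nonneg hA (by linarith)
      linarith
    have hs2 : 0 ≤ A * (algebraMap R ℝ v₁ + 1) + E - D (algebraMap R ℝ v₂ + 1) := by
      have : 0 ≤ A * (algebraMap R ℝ v₁ + 1) := mul_nonneg hA (by linarith)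
      linarith
    simp only [dualMDP, step, expect_map, expect_coin, potential, if_true,
      AgeState.monitorAge_idle, AgeState.monitorAge_busy, AgeState.effectiveAge_idle,
      AgeState.effectiveAge_busy, map_one, map_add, Bool.false_eq_true, if_false, add_zero]
    rw [mix_ofReal hq hs1 hs2, ← ENNReal.ofReal_coe_nnreal (p := α),
      ← ENNReal.ofReal_mul α.coe_nonneg, ← ENNReal.ofReal_add (by linarith) (by positivity)]
    congr 1
    rw [hγ, hc]
    linear_combination (-algebraMap R ℝ v₁) * hAeq

variable {N : ℕ}

/-- Sampling loses `D(x) ≥ 0`, and waiting loses `c (u - x)⁺ - c (u - x) ≥ 0`, by the recursion for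
`D`. -/
theorem potential_add_le (hR : Monotone (algebraMap R ℝ)) (hA : 0 ≤ A)
    (hAeq : A = 1 + α * (1 - q) * A) (hc : c = α * q * A)
    (hγ : γ = α * A + c * u + α * E - E) (hγ0 : 0 ≤ γ) (hu0 : 0 ≤ u) (huN : u ≤ N)
    (hE : excess c α u N 0 ≤ E) (hlam : (lam : ℝ) = excess c α u N 0) (s : AgeState R) (a : Bool) :
    potential A E (excess c α u N) s + ENNReal.ofReal γ ≤ (dualMDP R q hq lam).cost s a
        + α * expect ((dualMDP R q hq lam).trans s a) (potential A E (excess c α u N)) := by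
  have hc0 : 0 ≤ c := by rw [hc]; positivity
  have hDE : ∀ x, 0 ≤ x → excess c α u N x ≤ E := fun x hx =>
    (excess_antitone hc0 α.coe_nonneg hx).trans hE
  have h1 := one_le_algebraMap hR s.one_le_monitorAge
  have h2 := one_le_algebraMap hR s.one_le_effectiveAge
  have h3 := hDE _ (zero_le_one.trans h2)
  have h4 : 0 ≤ A * algebraMap R ℝ s.monitorAge := mul_nonneg hA (by linarith)
  have h5 := excess_nonneg (u := u) (N := N) hc0 α.coe_nonneg (algebraMap R ℝ s.effectiveAge)
  rw [potential, ← ENNReal.ofReal_add (by linarith) hγ0]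
  rcases a with _ | _
  · rw [actionValue_wait hq hR hA hAeq hc hDE hγ]
    refine ENNReal.ofReal_le_ofReal ?_
    rw [excess_rec (x := algebraMap R ℝ s.effectiveAge) (by linarith)]
    have := mul_le_mul_of_nonneg_left (le_max_left (u - algebraMap R ℝ s.effectiveAge) 0) hc0
    linarith
  · rw [actionValue_sample hq hR hA hAeq hDE hγ]
    · exact ENNReal.ofReal_le_ofReal (by linarith)
    · rw [hlam, excess_rec (by linarith), sub_zero, max_eq_left hu0, zero_add]

/-- Both losses vanish on their side of the threshold: `D(x) = 0` for `x ≥ u`, and `(u - x)⁺ = u -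
x` for `x < u`. -/
theorem le_potential_add (hR : Monotone (algebraMap R ℝ)) (hA : 0 ≤ A)
    (hAeq : A = 1 + α * (1 - q) * A) (hc : c = α * q * A)
    (hγ : γ = α * A + c * u + α * E - E) (hγ0 : 0 ≤ γ) (hu0 : 0 ≤ u) (huN : u ≤ N)
    (hE : excess c α u N 0 ≤ E) (hlam : (lam : ℝ) = excess c α u N 0) {f : AgeState R → Bool}
    (hf : ∀ s, f s = true ↔ u ≤ algebraMap R ℝ s.effectiveAge) (s : AgeState R) :
    (dualMDP R q hq lam).cost s (f s)
        + α * expect ((dualMDP R q hq lam).trans s (f s)) (potential A E (excess c α u N)) ≤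
      potential A E (excess c α u N) s + ENNReal.ofReal γ := by
  have hc0 : 0 ≤ c := by rw [hc]; positivity
  have hDE : ∀ x, 0 ≤ x → excess c α u N x ≤ E := fun x hx =>
    (excess_antitone hc0 α.coe_nonneg hx).trans hE
  have h1 := one_le_algebraMap hR s.one_le_monitorAge
  have h2 := one_le_algebraMap hR s.one_le_effectiveAge
  have h3 := hDE _ (zero_le_one.trans h2)
  have h4 : 0 ≤ A * algebraMap R ℝ s.monitorAge := mul_nonneg hA (by linarith)
  rw [potential, ← ENNReal.ofReal_add (by linarith) hγ0]
  by_cases hs : u ≤ algebraMap R ℝ s.effectiveAge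
  · rw [(hf s).2 hs, actionValue_sample hq hR hA hAeq hDE hγ, excess_eq_zero hs]
    · exact ENNReal.ofReal_le_ofReal (by linarith)
    · rw [hlam, excess_rec (by linarith), sub_zero, max_eq_left hu0, zero_add]
  · have hfs : f s = false := by
      rw [← Bool.not_eq_true, hf]
      exact hs
    rw [hfs, actionValue_wait hq hR hA hAeq hc hDE hγ,
      excess_rec (x := algebraMap R ℝ s.effectiveAge) (by linarith),
      max_eq_left (by linarith : 0 ≤ u - algebraMap R ℝ s.effectiveAge)]
    exact ENNReal.ofReal_le_ofReal (by linarith)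

end Potential

/-! ### The discounted problem -/

/-- The expected discounted number of slots up to and including the first successful
transmission. -/
noncomputable def deliveryFactor (q α : ℝ≥0) : ℝ := 1 / (1 - α * (1 - q))

section DeliveryFactor

variable {q α : ℝ≥0}

theorem deliveryFactor_denom_pos (hq_pos : 0 < q) (hq : q ≤ 1) (hα : α ≤ 1) :
    (0 : ℝ) < 1 - α * (1 - q) := by
  have h1 : (0 : ℝ) ≤ 1 - q := sub_nonneg.2 (by exact_mod_cast hq)
  have h2 : (α : ℝ) ≤ 1 := by exact_mod_cast hα
  have h3 : (0 : ℝ) < q := by exact_mod_cast hq_pos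
  nlinarith

theorem deliveryFactor_pos (hq_pos : 0 < q) (hq : q ≤ 1) (hα : α ≤ 1) :
    0 < deliveryFactor q α :=
  one_div_pos.2 (deliveryFactor_denom_pos hq_pos hq hα)

theorem deliveryFactor_eq (hq_pos : 0 < q) (hq : q ≤ 1) (hα : α ≤ 1) :
    deliveryFactor q α = 1 + α * (1 - q) * deliveryFactor q α := by
  have := deliveryFactor_denom_pos hq_pos hq hα
  rw [deliveryFactor]
  field_simp
  ring

end DeliveryFactor

/-- The multiplier at which `(u, ∞)` is the indifference point. -/
noncomputable def indifferenceMultiplier (q : ℝ≥0) (u : ℝ) (N : ℕ) (α : ℝ≥0) : ℝ :=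
  excess (α * q * deliveryFactor q α) α u N 0

section Discounted

variable {q α lam : ℝ≥0} {u v : ℝ} {N : ℕ}

theorem monotone_algebraMap_real : Monotone (algebraMap ℝ ℝ) := monotone_id

theorem coeff_nonneg (hq_pos : 0 < q) (hq : q ≤ 1) (hα : α ≤ 1) :
    0 ≤ α * q * deliveryFactor q α := by
  have := (deliveryFactor_pos hq_pos hq hα).le
  positivity

/-- The optimal discounted cost of sampling, less the part that is linear in the monitor age. -/
noncomputable def discountedLevel (q α : ℝ≥0) (u : ℝ) : ℝ :=
  (α * deliveryFactor q α + α * q * deliveryFactor q α * u) / (1 - α)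

/-- The level is the choice of `E` that makes the constant `γ` zero. -/
theorem discountedLevel_eq (hα : α < 1) :
    0 = α * deliveryFactor q α + α * q * deliveryFactor q α * u + α * discountedLevel q α u
      - discountedLevel q α u := by
  have : (0 : ℝ) < 1 - α := sub_pos.2 (by exact_mod_cast hα)
  rw [discountedLevel]
  field_simp
  ring

theorem indifferenceMultiplier_le_discountedLevel (hq_pos : 0 < q) (hq : q ≤ 1) (hα : α < 1)
    (hu0 : 0 ≤ u) : indifferenceMultiplier q u N α ≤ discountedLevel q α u := by
  have h1 : (0 : ℝ) < 1 - α := sub_pos.2 (by exact_mod_cast hα)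
  have h2 := (deliveryFactor_pos hq_pos hq hα.le).le
  refine (excess_zero_le (coeff_nonneg hq_pos hq hα.le) α.coe_nonneg
    (by exact_mod_cast hα) hu0).trans ?_
  rw [discountedLevel]
  gcongr
  exact le_add_of_nonneg_left (by positivity)

open Classical in
theorem discountedValue_eq (hq_pos : 0 < q) (hq : q ≤ 1) (hα : α < 1) (hu0 : 0 ≤ u) (huN : u ≤ N)
    (hlam : (lam : ℝ) = indifferenceMultiplier q u N α) :
    discountedValue (dualMDP ℝ q hq lam) α =
      potential (deliveryFactor q α) (discountedLevel q α u)
        (excess (α * q * deliveryFactor q α) α u N) := by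
  have hA := (deliveryFactor_pos hq_pos hq hα.le).le
  have hc := coeff_nonneg hq_pos hq hα.le
  have hE := indifferenceMultiplier_le_discountedLevel (N := N) hq_pos hq hα hu0
  funext s
  refine le_antisymm ?_ ?_
  · refine discountedValue_le _ s (f := fun s => decide (u ≤ algebraMap ℝ ℝ s.effectiveAge)) ?_
    intro x
    simpa using le_potential_add hq monotone_algebraMap_real hA
      (deliveryFactor_eq hq_pos hq hα.le) rfl (discountedLevel_eq hα) le_rfl hu0 huN hE hlam
      (f := fun s => decide (u ≤ algebraMap ℝ ℝ s.effectiveAge)) (by simp) x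
  · refine le_discountedValue _ s hα (ENNReal.ofReal_ne_top) ENNReal.ofReal_ne_top
      (expect_step_potential_le q hq monotone_algebraMap_real hA
        (excess_nonneg hc α.coe_nonneg) fun x hx =>
          (excess_antitone hc α.coe_nonneg hx).trans hE) ?_
    intro x a
    simpa using potential_add_le hq monotone_algebraMap_real hA
      (deliveryFactor_eq hq_pos hq hα.le) rfl (discountedLevel_eq hα) le_rfl hu0 huN hE hlam x a

/-- Because `D(v + 1) = 0` for `u ≤ v`, the two values differ by `c (v - u)`, and `c > 0`. -/
theorem discountedActionValue_eq_iff (hq_pos : 0 < q) (hq : q ≤ 1) (hα0 : 0 < α) (hα : α < 1)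
    (hu0 : 0 ≤ u) (huN : u ≤ N) (hlam : (lam : ℝ) = indifferenceMultiplier q u N α)
    (hv : 1 ≤ v) (huv : u ≤ v) :
    discountedActionValue (dualMDP ℝ q hq lam) α (.idle v hv) false =
      discountedActionValue (dualMDP ℝ q hq lam) α (.idle v hv) true ↔ u = v := by
  have hA := deliveryFactor_pos hq_pos hq hα.le
  have hc := coeff_nonneg hq_pos hq hα.le
  have hE := indifferenceMultiplier_le_discountedLevel (N := N) hq_pos hq hα hu0
  have hDE : ∀ x, 0 ≤ x → excess (α * q * deliveryFactor q α) α u N x ≤ discountedLevel q α u :=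
    fun x hx => (excess_antitone hc α.coe_nonneg hx).trans hE
  have hE0 : 0 ≤ discountedLevel q α u :=
    (excess_nonneg hc α.coe_nonneg 0).trans (hDE 0 le_rfl)
  have hc' : 0 < α * q * deliveryFactor q α := by positivity
  have hAeq := deliveryFactor_eq hq_pos hq hα.le
  rw [discountedActionValue, discountedActionValue,
    discountedValue_eq hq_pos hq hα hu0 huN hlam,
    actionValue_sample hq monotone_algebraMap_real hA.le hAeq hDE (discountedLevel_eq hα),
    actionValue_wait hq monotone_algebraMap_real hA.le hAeq rfl hDE (discountedLevel_eq hα)]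
  · simp only [AgeState.monitorAge_idle, AgeState.effectiveAge_idle, Algebra.algebraMap_self,
      RingHom.id_apply, add_zero]
    have h1 : 0 ≤ deliveryFactor q α * v := mul_nonneg hA.le (by linarith)
    have h2 := mul_nonneg hc (sub_nonneg.2 huv)
    rw [excess_eq_zero (by linarith : u ≤ v + 1), mul_zero, sub_zero,
      ENNReal.ofReal_eq_ofReal_iff (by linarith) (by linarith), add_eq_left, mul_eq_zero,
      or_iff_right hc'.ne', sub_eq_zero, eq_comm]
  · rw [hlam, indifferenceMultiplier, excess_rec (by linarith), sub_zero, max_eq_left hu0,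
      zero_add]

theorem continuous_indifferenceMultiplier :
    Continuous fun u : ℝ => indifferenceMultiplier q u N α := by
  unfold indifferenceMultiplier excess
  fun_prop

theorem criticalMultiplier_eq (hq_pos : 0 < q) (hq : q ≤ 1) (hα0 : 0 < α) (hα : α < 1)
    (hv : 1 ≤ v) (hvN : v ≤ N) :
    criticalMultiplier q hq v hv α = ENNReal.ofReal (indifferenceMultiplier q v N α) := by
  have hv0 : 0 ≤ v := zero_le_one.trans hv
  have h0 : 0 ≤ indifferenceMultiplier q v N α :=
    excess_nonneg (coeff_nonneg hq_pos hq hα.le) α.coe_nonneg 0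
  refine le_antisymm ?_ ?_
  · refine iInf₂_le (indifferenceMultiplier q v N α).toNNReal ?_
    exact (discountedActionValue_eq_iff hq_pos hq hα0 hα hv0 hvN
      (Real.coe_toNNReal _ h0) hv le_rfl).2 rfl
  · refine le_iInf₂ fun lam hlam => ?_
    rw [← ENNReal.ofReal_coe_nnreal]
    refine ENNReal.ofReal_le_ofReal ?_
    by_contra! hlt
    -- A multiplier below the claimed one belongs to a threshold `u` in `[0, v]` by the intermediate
    -- value theorem; indifference at `v` then forces `u = v`.
    have hz : indifferenceMultiplier q 0 N α = 0 := excess_eq_zero le_rfl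
    obtain ⟨u, ⟨hu0, huv⟩, hu⟩ := intermediate_value_Icc hv0
      (continuous_indifferenceMultiplier (q := q) (α := α) (N := N)).continuousOn
      (show (lam : ℝ) ∈ _ from ⟨hz.le.trans lam.coe_nonneg, hlt.le⟩)
    have := (discountedActionValue_eq_iff hq_pos hq hα0 hα hu0 (huv.trans hvN) hu.symm hv huv).1
      hlam
    rw [this] at hu
    exact hlt.ne' hu

theorem tendsto_indifferenceMultiplier (hq_pos : 0 < q) :
    Tendsto (fun α : ℝ≥0 => indifferenceMultiplier q v N α) (𝓝 1)
      (𝓝 (indifferenceMultiplier q v N 1)) := by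
  refine ContinuousAt.tendsto (f := fun α : ℝ≥0 => indifferenceMultiplier q v N α) ?_
  unfold indifferenceMultiplier excess deliveryFactor
  -- The denominator of the delivery factor equals `q` at `α = 1`.
  have : (1 - ((1 : ℝ≥0) : ℝ) * (1 - q)) ≠ 0 := by simpa using hq_pos.ne'
  fun_prop (disch := assumption)

theorem tendsto_criticalMultiplier (hq_pos : 0 < q) (hq : q ≤ 1) (hv : 1 ≤ v) (hvN : v ≤ N) :
    Tendsto (fun α : ℝ≥0 => criticalMultiplier q hq v hv α) (𝓝[<] 1)
      (𝓝 (ENNReal.ofReal (indifferenceMultiplier q v N 1))) := by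
  refine ((ENNReal.continuous_ofReal.tendsto _).comp
    ((tendsto_indifferenceMultiplier hq_pos).mono_left nhdsWithin_le_nhds)).congr' ?_
  filter_upwards [self_mem_nhdsWithin,
    nhdsWithin_le_nhds (lt_mem_nhds (zero_lt_one : (0 : ℝ≥0) < 1))] with α hα hα0
  exact (criticalMultiplier_eq hq_pos hq hα0 hα hv hvN).symm

end Discounted

/-! ### The average-cost problem -/

section Average

variable {q lam : ℝ≥0} {v : ℝ} {N : ℕ}

theorem monotone_algebraMap_nat : Monotone (algebraMap ℕ ℝ) := by
  intro a b hab
  simpa using hab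

/-- The optimal average cost. -/
noncomputable def averageLevel (q : ℝ≥0) (v : ℝ) : ℝ :=
  deliveryFactor q 1 + q * deliveryFactor q 1 * v

/-- The relative value function. -/
noncomputable def relativeValue (q : ℝ≥0) (v : ℝ) (N : ℕ) : AgeState ℕ → ℝ≥0∞ :=
  potential (deliveryFactor q 1) (indifferenceMultiplier q v N 1)
    (excess ((1 : ℝ≥0) * q * deliveryFactor q 1) (1 : ℝ≥0) v N)

/-- At `α = 1` the constant `E` cancels, so it is free; `E = D(0)` is enough to keep the relative
value nonnegative. -/
theorem averageLevel_eq : averageLevel q v =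
    (1 : ℝ≥0) * deliveryFactor q 1 + (1 : ℝ≥0) * q * deliveryFactor q 1 * v
      + (1 : ℝ≥0) * indifferenceMultiplier q v N 1 - indifferenceMultiplier q v N 1 := by
  rw [averageLevel, NNReal.coe_one]
  ring

theorem averageLevel_nonneg (hq_pos : 0 < q) (hq : q ≤ 1) (hv : 1 ≤ v) : 0 ≤ averageLevel q v := by
  have := (deliveryFactor_pos hq_pos hq le_rfl).le
  have hv0 : 0 ≤ v := zero_le_one.trans hv
  unfold averageLevel
  positivity

theorem relativeValue_add_le (hq_pos : 0 < q) (hq : q ≤ 1) (hv : 1 ≤ v) (hvN : v ≤ N)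
    (hlam : (lam : ℝ) = indifferenceMultiplier q v N 1) (s : AgeState ℕ) (a : Bool) :
    relativeValue q v N s + ENNReal.ofReal (averageLevel q v) ≤ (dualMDP ℕ q hq lam).cost s a
      + expect ((dualMDP ℕ q hq lam).trans s a) (relativeValue q v N) := by
  have h := potential_add_le hq monotone_algebraMap_nat (deliveryFactor_pos hq_pos hq le_rfl).le
    (deliveryFactor_eq hq_pos hq le_rfl) rfl (averageLevel_eq (N := N))
    (averageLevel_nonneg hq_pos hq hv) (zero_le_one.trans hv) hvN le_rfl hlam s a
  rwa [ENNReal.coe_one, one_mul] at h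

theorem le_relativeValue_add (hq_pos : 0 < q) (hq : q ≤ 1) (hv : 1 ≤ v) (hvN : v ≤ N)
    (hlam : (lam : ℝ) = indifferenceMultiplier q v N 1) (s : AgeState ℕ) :
    (dualMDP ℕ q hq lam).cost s (thresholdRule v s)
      + expect ((dualMDP ℕ q hq lam).trans s (thresholdRule v s)) (relativeValue q v N) ≤
    relativeValue q v N s + ENNReal.ofReal (averageLevel q v) := by
  have h := le_potential_add hq monotone_algebraMap_nat (deliveryFactor_pos hq_pos hq le_rfl).le
    (deliveryFactor_eq hq_pos hq le_rfl) rfl (averageLevel_eq (N := N))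
    (averageLevel_nonneg hq_pos hq hv) (zero_le_one.trans hv) hvN le_rfl hlam
    (f := thresholdRule v) (by simp [thresholdRule]) s
  rwa [ENNReal.coe_one, one_mul] at h

theorem relativeValue_le (hq_pos : 0 < q) (hq : q ≤ 1) (s : AgeState ℕ) :
    relativeValue q v N s ≤
      ENNReal.ofReal (deliveryFactor q 1) * ENNReal.ofReal (algebraMap ℕ ℝ s.monitorAge)
        + ENNReal.ofReal (indifferenceMultiplier q v N 1) := by
  have hA := (deliveryFactor_pos hq_pos hq le_rfl).le
  rw [← ENNReal.ofReal_mul hA]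
  refine le_trans (ENNReal.ofReal_le_ofReal ?_) ENNReal.ofReal_add_le
  exact sub_le_self _ (excess_nonneg (coeff_nonneg hq_pos hq le_rfl) NNReal.zero_le_coe _)

/-- No policy has a smaller long-run average cost than `averageLevel q v`. -/
theorem averageLevel_le_liminf (hq_pos : 0 < q) (hq : q ≤ 1) (hv : 1 ≤ v) (hvN : v ≤ N)
    (hlam : (lam : ℝ) = indifferenceMultiplier q v N 1) (π : Policy (AgeState ℕ) Bool) :
    ENNReal.ofReal (averageLevel q v) ≤
      liminf (cesaro (stageCost (dualMDP ℕ q hq lam) π initState)) atTop := by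
  set age : AgeState ℕ → ℝ≥0∞ := fun x => ENNReal.ofReal (algebraMap ℕ ℝ x.monitorAge) with hage
  refine le_liminf_cesaro (m := stateExpect (dualMDP ℕ q hq lam) π initState age)
    (A := (deliveryFactor q 1).toNNReal) (C := (indifferenceMultiplier q v N 1).toNNReal) ?_
    (stateExpect_succ_le _ _ _ (expect_step_monitorAge_le q hq monotone_algebraMap_nat)) ?_ ?_
  · simp [stateExpect_zero, hage, initState]
  · intro n
    rw [stageCost_eq]
    refine expect_mono _ fun hx => ?_
    rw [← expect_const (π hx.1 hx.2) (age hx.2)]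
    exact expect_mono _ fun a => le_self_add
  · intro n
    refine le_self_add.trans ((mul_add_le_sum_stageCost _ π initState
      (relativeValue_add_le hq_pos hq hv hvN hlam) n).trans ?_)
    rw [add_assoc]
    refine add_le_add_right ?_ _
    rw [stateExpect, stateExpect, ← expect_const_mul,
      ← expect_const (historyLaw (dualMDP ℕ q hq lam) π initState n)
        ((indifferenceMultiplier q v N 1).toNNReal : ℝ≥0∞), ← expect_add]
    exact expect_mono _ fun hx => relativeValue_le hq_pos hq hx.2

/-- `Φ` need only be finite at the initial state; the modified rule uses a `Φ` with an infinite
value. -/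
theorem tendsto_cesaro_of_supersolution (hq_pos : 0 < q) (hq : q ≤ 1) (hv : 1 ≤ v) (hvN : v ≤ N)
    (hlam : (lam : ℝ) = indifferenceMultiplier q v N 1) {f : AgeState ℕ → Bool}
    {Φ : AgeState ℕ → ℝ≥0∞} (hΦ : Φ initState ≠ ∞)
    (h : ∀ x, (dualMDP ℕ q hq lam).cost x (f x) + expect ((dualMDP ℕ q hq lam).trans x (f x)) Φ ≤
      Φ x + ENNReal.ofReal (averageLevel q v)) :
    Tendsto (cesaro (stageCost (dualMDP ℕ q hq lam) (stationary f) initState)) atTop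
      (𝓝 (ENNReal.ofReal (averageLevel q v))) := by
  refine tendsto_cesaro (C := (Φ initState).toNNReal)
    (averageLevel_le_liminf hq_pos hq hv hvN hlam _) fun n => ?_
  rw [ENNReal.coe_toNNReal hΦ]
  exact sum_stageCost_le _ _ h n

theorem tendsto_cesaro_thresholdRule (hq_pos : 0 < q) (hq : q ≤ 1) (hv : 1 ≤ v) (hvN : v ≤ N)
    (hlam : (lam : ℝ) = indifferenceMultiplier q v N 1) :
    Tendsto (cesaro (stageCost (dualMDP ℕ q hq lam) (stationary (thresholdRule v)) initState))
      atTop (𝓝 (ENNReal.ofReal (averageLevel q v))) :=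
  tendsto_cesaro_of_supersolution hq_pos hq hv hvN hlam ENNReal.ofReal_ne_top
    (le_relativeValue_add hq_pos hq hv hvN hlam)

/-- The state `(1, 1)`, which no transition enters. -/
def unreachableState : AgeState ℕ := .busy 1 1 le_rfl le_rfl

/-- A success leaves no packet, and a failure makes the monitor age at least 2, so `(1, 1)` is never
entered. -/
theorem expect_step_congr (hq : q ≤ 1) {Φ Ψ : AgeState ℕ → ℝ≥0∞}
    (h : ∀ x, x ≠ unreachableState → Φ x = Ψ x) (s : AgeState ℕ) (a : Bool) :
    expect (step q hq s a) Φ = expect (step q hq s a) Ψ := by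
  have hs : s.monitorAge ≠ 0 := (Nat.one_le_iff_ne_zero.1 s.one_le_monitorAge)
  rcases a with _ | _
  · rcases s with ⟨v₁, h₁⟩ | ⟨v₁, v₂, h₂, h₁₂⟩
    · simp only [step, expect_pure]
      exact h _ (by simp [unreachableState])
    · simp only [step, expect_map]
      congr 1
      funext x
      have : v₁ ≠ 0 := hs
      cases x
      · exact h _ (by simp [unreachableState, this])
      · exact h _ (by simp [unreachableState])
  · simp only [step, expect_map]
    congr 1
    funext x
    cases x
    · exact h _ (by simpa [unreachableState] using hs)
    · exact h _ (by simp [unreachableState])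

open Classical in
/-- The threshold rule, changed in the unreachable state. -/
noncomputable def modifiedRule (v : ℝ) : AgeState ℕ → Bool :=
  Function.update (thresholdRule v) unreachableState (!thresholdRule v unreachableState)

open Classical in
theorem tendsto_cesaro_modifiedRule (hq_pos : 0 < q) (hq : q ≤ 1) (hv : 1 ≤ v) (hvN : v ≤ N)
    (hlam : (lam : ℝ) = indifferenceMultiplier q v N 1) :
    Tendsto (cesaro (stageCost (dualMDP ℕ q hq lam) (stationary (modifiedRule v)) initState))
      atTop (𝓝 (ENNReal.ofReal (averageLevel q v))) := by
  refine tendsto_cesaro_of_supersolution hq_pos hq hv hvN hlam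
    (Φ := Function.update (relativeValue q v N) unreachableState ∞) ?_ fun x => ?_
  · rw [Function.update_of_ne (by simp [initState, unreachableState])]
    exact ENNReal.ofReal_ne_top
  · by_cases hx : x = unreachableState
    -- The value `∞` makes the inequality trivial here, whatever action the rule takes.
    · simp [hx]
    · rw [modifiedRule, Function.update_of_ne hx, Function.update_of_ne hx]
      refine le_of_eq_of_le ?_ (le_relativeValue_add hq_pos hq hv hvN hlam x)
      congr 1
      exact expect_step_congr hq (fun y hy => Function.update_of_ne hy _ _) _ _

open Classical in
/-- The mixture with equal weights of the threshold rule and the modified threshold rule. -/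
noncomputable def modulatedThreshold (v : ℝ) : BernoulliModulated (AgeState ℕ) Bool where
  f := thresholdRule v
  g := modifiedRule v
  p := 1 / 2
  p_pos := by norm_num
  p_lt_one := by
    rw [← NNReal.coe_lt_coe]
    norm_num
  differ_once := ⟨unreachableState, by simp [modifiedRule], fun s hs => by
    rw [modifiedRule, Function.update_of_ne hs]⟩

end Average

end AgeSampling

theorem mainTheorem3 (q : ℝ≥0) (hq_pos : 0 < q) (hq : q ≤ 1) (v : ℝ) (hv : 1 ≤ v) :
    ∃ lamBar : ℝ≥0,
      Tendsto (fun α : ℝ≥0 => AgeSampling.criticalMultiplier q hq v hv α) (𝓝[<] 1)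
        (𝓝 (lamBar : ℝ≥0∞)) ∧
      ∃ J : ℝ≥0∞,
        Tendsto (AgeSampling.cesaro (AgeSampling.stageCost (AgeSampling.dualMDP ℕ q hq lamBar)
          (AgeSampling.stationary (AgeSampling.thresholdRule v)) AgeSampling.initState))
          atTop (𝓝 J) ∧
        (∀ π : AgeSampling.BernoulliModulated (AgeSampling.AgeState ℕ) Bool,
          J ≤ liminf (AgeSampling.cesaro (π.stageCost (AgeSampling.dualMDP ℕ q hq lamBar)
            AgeSampling.initState)) atTop) ∧
        IsGLB {L : ℝ≥0∞ | ∃ π : AgeSampling.BernoulliModulated (AgeSampling.AgeState ℕ) Bool,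
          Tendsto (AgeSampling.cesaro (π.stageCost (AgeSampling.dualMDP ℕ q hq lamBar)
            AgeSampling.initState)) atTop (𝓝 L)} J := by
  obtain ⟨N, hvN⟩ := exists_nat_ge v
  have h0 : 0 ≤ AgeSampling.indifferenceMultiplier q v N 1 :=
    AgeSampling.excess_nonneg (AgeSampling.coeff_nonneg hq_pos hq le_rfl) NNReal.zero_le_coe 0
  have hlam := Real.coe_toNNReal _ h0
  have hlow : ∀ π : AgeSampling.BernoulliModulated (AgeSampling.AgeState ℕ) Bool,
      ENNReal.ofReal (AgeSampling.averageLevel q v) ≤ liminf (AgeSampling.cesaro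
        (π.stageCost (AgeSampling.dualMDP ℕ q hq
          (AgeSampling.indifferenceMultiplier q v N 1).toNNReal) AgeSampling.initState)) atTop :=
    fun π => π.le_liminf_cesaro _ _ fun f =>
      AgeSampling.averageLevel_le_liminf hq_pos hq hv hvN hlam _
  have hthreshold := AgeSampling.tendsto_cesaro_thresholdRule hq_pos hq hv hvN hlam
  refine ⟨_, AgeSampling.tendsto_criticalMultiplier hq_pos hq hv hvN, _, hthreshold, hlow, ?_, ?_⟩
  · rintro L ⟨π, hπ⟩
    exact (hlow π).trans_eq hπ.liminf_eq
  -- A mixture needs two distinct policies and `0 < p < 1`, so the bare threshold rule is no member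
  -- of the class; the mixture with its modification has the same limit.
  · intro L hL
    exact hL ⟨AgeSampling.modulatedThreshold v, (AgeSampling.modulatedThreshold v).tendsto_cesaro
      _ _ hthreshold (AgeSampling.tendsto_cesaro_modifiedRule hq_pos hq hv hvN hlam)⟩
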